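/- Let $n\geq 1$ and let $\mathbb F_n^+$ be the unital free semigroup with generators $g_1,\dots,g_n$ and identity $g_0$; let $|\alpha|$ be the length of a word $\alpha$. Let $F^2(H_n)$ be the full Fock space of an $n$-dimensional complex Hilbert space $H_n$, with its orthonormal basis $\{e_\alpha\}_{\alpha\in\mathbb F_n^+}$ (that is, $\ell^2(\mathbb F_n^+)$). Let $\boldsymbol\mu=\{\mu_\beta\}_{|\beta|\ge 1}$ be strictly positive real numbers. Put $\boldsymbol\mu(g_0,g_0)=1$ and $\boldsymbol\mu(\beta,g_0)=\mu_{g_{i_1}\cdots g_{i_p}}\,\mu_{g_{i_2}\cdots g_{i_p}}\cdots\mu_{g_{i_p}}$ for $\beta=g_{i_1}\cdots g_{i_p}$, and assume that for every $i\in\{1,\dots,n\}$ $$\sup_{\alpha\in\mathbb F_n^+}\mu_{g_i\alpha}<\infty\qquad\text{and}\qquad \sup_{\alpha\in\mathbb F_n^+}\frac{\boldsymbol\mu(\alpha g_i,g_0)}{\boldsymbol\mu(\alpha,g_0)}<\infty .$$ Let $W_1,\dots,W_n$ be the bounded operators on $F^2(H_n)$ with $W_ie_\alpha=\mu_{g_i\alpha}e_{g_i\alpha}$.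 For $\lambda\in\mathbb C^n$ put $\lambda_{g_0}=1$ and $\lambda_\alpha=\lambda_{i_1}\cdots\lambda_{i_p}$ if $\alpha=g_{i_1}\cdots g_{i_p}$. Let $\mathcal D(\boldsymbol\mu)$ be the set of all $\lambda\in\mathbb C^n$ for which there is $C>0$ such that $$\Big|\sum_\alpha c_\alpha\lambda_\alpha\Big|\le C\Big(\sum_\alpha\boldsymbol\mu(\alpha,g_0)^2|c_\alpha|^2\Big)^{1/2}$$ for all finitely supported families $(c_\alpha)_{\alpha\in\mathbb F_n^+}$ of complex numbers, and assume that $\mathcal D(\boldsymbol\mu)$ contains a neighborhood of the origin. For $\mathbf k\in\mathbb N_0^n$ let $\Lambda_{\mathbf k}$ be the finite set of all $\alpha\in\mathbb F_n^+$ with $\lambda_\alpha=\lambda^{\mathbf k}$ for all $\lambda\in\mathbb C^n$, and put $$\omega_{\mathbf k}=\sum_{\alpha\in\Lambda_{\mathbf k}}\frac1{\boldsymbol\mu(\alpha,g_0)^2},\qquad y^{(\mathbf k)}=\frac1{\omega_{\mathbf k}}\sum_{\alpha\in\Lambda_{\mathbf k}}\frac1{\boldsymbol\mu(\alpha,g_0)}\,e_\alpha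 .$$ Let $F_s^2(\boldsymbol\mu)\subset F^2(H_n)$ be the closed linear span of $\{y^{(\mathbf k)}:\mathbf k\in\mathbb N_0^n\}$, let $B_i=P_{F_s^2(\boldsymbol\mu)}W_i|_{F_s^2(\boldsymbol\mu)}$ for $i=1,\dots,n$, and let $F_s^\infty(\boldsymbol\mu)$ be the $w^*$-closed (non-self-adjoint) subalgebra of $B(F_s^2(\boldsymbol\mu))$ generated by $B_1,\dots,B_n$ and the identity. For a set $\mathcal U$ of bounded operators on a Hilbert space $\mathcal H$ let $\operatorname{Lat}\mathcal U$ be the set of all closed subspaces of $\mathcal H$ that are invariant under every $A\in\mathcal U$; for a set $\mathcal S$ of closed subspaces let $\operatorname{Alg}\mathcal S$ be the set of all $A\in B(\mathcal H)$ that leave every member of $\mathcal S$ invariant. Then $F_s^\infty(\boldsymbol\mu)$ is reflexive, that is, $$F_s^\infty(\boldsymbol\mu)=\operatorname{Alg}\operatorname{Lat}F_s^\infty(\boldsymbol\mu).$$ -/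

import Mathlib

open scoped Topology

namespace WeightedFock

/-! ### The free semigroup, weights and the full Fock space

The unital free semigroup on `g_1, …, g_n` is `FreeMonoid (Fin n)`; its identity `g_0` is `1`. -/

/-- The product `μ(β, g_0) = μ_{g_{i_1} ⋯ g_{i_p}} μ_{g_{i_2} ⋯ g_{i_p}} ⋯ μ_{g_{i_p}}` of the
weights of all nonempty suffixes of a word `β = g_{i_1} ⋯ g_{i_p}`, the word being given by its
list of letters. -/
def weightProdList {n : ℕ} (μ : FreeMonoid (Fin n) → ℝ) : List (Fin n) → ℝ
  | [] => 1
  | i :: l => μ (FreeMonoid.ofList (i :: l)) * weightProdList μ l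

/-- The number `μ(β, g_0)`; it is `1` for `β = g_0`. -/
def weightProd {n : ℕ} (μ : FreeMonoid (Fin n) → ℝ) (β : FreeMonoid (Fin n)) : ℝ :=
  weightProdList μ (FreeMonoid.toList β)

/-- A weight sequence `{μ_β}_{|β| ≥ 1}` of strictly positive numbers for which the weighted left
and the weighted right multi-shifts are bounded. The value of `μ` at the identity is irrelevant:
it is not used anywhere. -/
structure IsWeightSequence {n : ℕ} (μ : FreeMonoid (Fin n) → ℝ) : Prop where
  pos : ∀ β, β ≠ 1 → 0 < μ β
  bddAbove_left : ∀ i, BddAbove (Set.range fun α => μ (FreeMonoid.of i * α))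
  bddAbove_right : ∀ i, BddAbove (Set.range fun α =>
    weightProd μ (α * FreeMonoid.of i) / weightProd μ α)

/-- The full Fock space `F²(H_n)`, realized as `ℓ²` over the free semigroup: the orthonormal basis
`e_α = e_{i_1} ⊗ ⋯ ⊗ e_{i_k}` is the standard basis of `ℓ²`. -/
abbrev FockSpace (n : ℕ) : Type := lp (fun _ : FreeMonoid (Fin n) => ℂ) 2

instance freeMonoidDecidableEq {n : ℕ} : DecidableEq (FreeMonoid (Fin n)) :=
  inferInstanceAs (DecidableEq (List (Fin n)))

/-- The basis vector `e_α`. -/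
noncomputable def fockBasis {n : ℕ} (α : FreeMonoid (Fin n)) : FockSpace n :=
  lp.single 2 α (1 : ℂ)

theorem of_mul_injective {n : ℕ} (i : Fin n) :
    Function.Injective fun α : FreeMonoid (Fin n) => FreeMonoid.of i * α :=
  mul_right_injective _

/-- The coordinates of `W_i f`: the coordinate at `g_i α` is `μ_{g_i α} f_α`, and the coordinate
at a word that does not begin with `g_i` is `0`. -/
noncomputable def shiftFun {n : ℕ} (μ : FreeMonoid (Fin n) → ℝ) (i : Fin n)
    (f : FreeMonoid (Fin n) → ℂ) : FreeMonoid (Fin n) → ℂ :=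
  Function.extend (fun α => FreeMonoid.of i * α) (fun α => (μ (FreeMonoid.of i * α) : ℂ) * f α) 0

theorem shiftFun_of_mul {n : ℕ} (μ : FreeMonoid (Fin n) → ℝ) (i : Fin n)
    (f : FreeMonoid (Fin n) → ℂ) (α : FreeMonoid (Fin n)) :
    shiftFun μ i f (FreeMonoid.of i * α) = (μ (FreeMonoid.of i * α) : ℂ) * f α :=
  (of_mul_injective i).extend_apply _ _ α

theorem shiftFun_of_forall_ne {n : ℕ} (μ : FreeMonoid (Fin n) → ℝ) (i : Fin n)
    (f : FreeMonoid (Fin n) → ℂ) (β : FreeMonoid (Fin n))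
    (hβ : ∀ α, FreeMonoid.of i * α ≠ β) : shiftFun μ i f β = 0 :=
  Function.extend_apply' _ _ _ (by rintro ⟨α, h⟩; exact hβ α h)

theorem norm_sq_shiftFun {n : ℕ} (μ : FreeMonoid (Fin n) → ℝ) (i : Fin n)
    (f : FreeMonoid (Fin n) → ℂ) :
    (fun β => ‖shiftFun μ i f β‖ ^ 2) = Function.extend (fun α => FreeMonoid.of i * α)
      (fun α => ‖(μ (FreeMonoid.of i * α) : ℂ) * f α‖ ^ 2) 0 := by
  funext β
  by_cases h : ∃ α, FreeMonoid.of i * α = β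
  · obtain ⟨α, rfl⟩ := h
    have h := (of_mul_injective i).extend_apply
      (fun α => ‖(μ (FreeMonoid.of i * α) : ℂ) * f α‖ ^ 2) 0 α
    simp only [shiftFun_of_mul]
    exact h.symm
  · rw [shiftFun_of_forall_ne μ i f β (fun α hα => h ⟨α, hα⟩), Function.extend_apply' _ _ _ h]
    simp

theorem summable_norm_sq {n : ℕ} (f : FockSpace n) : Summable fun α => ‖f α‖ ^ 2 := by
  have h := (lp.hasSum_norm (p := 2) (by norm_num) f).summable
  simpa using h

theorem norm_sq_eq_tsum {n : ℕ} (f : FockSpace n) : ‖f‖ ^ 2 = ∑' α, ‖f α‖ ^ 2 := by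
  have h := lp.norm_rpow_eq_tsum (p := 2) (by norm_num) f
  simpa using h

theorem IsWeightSequence.exists_bound {n : ℕ} {μ : FreeMonoid (Fin n) → ℝ}
    (hμ : IsWeightSequence μ) (i : Fin n) :
    ∃ C : ℝ, 0 ≤ C ∧ ∀ (f : FreeMonoid (Fin n) → ℂ) (α : FreeMonoid (Fin n)),
      ‖(μ (FreeMonoid.of i * α) : ℂ) * f α‖ ^ 2 ≤ C ^ 2 * ‖f α‖ ^ 2 := by
  obtain ⟨C, hC⟩ := hμ.bddAbove_left i
  have hpos : ∀ α, 0 < μ (FreeMonoid.of i * α) := fun α =>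
    hμ.pos _ fun h => by simpa using congrArg FreeMonoid.length h
  have hle : ∀ α, μ (FreeMonoid.of i * α) ≤ C := fun α => hC ⟨α, rfl⟩
  refine ⟨C, (hpos 1).le.trans (hle 1), fun f α => ?_⟩
  rw [norm_mul, mul_pow, Complex.norm_real, Real.norm_of_nonneg (hpos α).le]
  have := pow_le_pow_left₀ (hpos α).le (hle α) 2
  gcongr

theorem IsWeightSequence.summable_shift {n : ℕ} {μ : FreeMonoid (Fin n) → ℝ}
    (hμ : IsWeightSequence μ) (i : Fin n) (f : FockSpace n) :
    Summable fun α => ‖(μ (FreeMonoid.of i * α) : ℂ) * f α‖ ^ 2 := by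
  obtain ⟨C, -, hC⟩ := hμ.exists_bound i
  exact Summable.of_nonneg_of_le (fun _ => by positivity) (hC f)
    ((summable_norm_sq f).mul_left _)

theorem IsWeightSequence.memℓp_shiftFun {n : ℕ} {μ : FreeMonoid (Fin n) → ℝ}
    (hμ : IsWeightSequence μ) (i : Fin n) (f : FockSpace n) :
    Memℓp (shiftFun μ i f) 2 := by
  refine memℓp_gen ?_
  have h : Summable fun β => ‖shiftFun μ i f β‖ ^ 2 := by
    rw [norm_sq_shiftFun]
    exact (summable_extend_zero (of_mul_injective i)).2 (hμ.summable_shift i f)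
  simpa using h

/-- The weighted left creation operator `W_i` on the full Fock space, `W_i e_α = μ_{g_i α}
e_{g_i α}`. -/
noncomputable def multiShift {n : ℕ} (μ : FreeMonoid (Fin n) → ℝ) (hμ : IsWeightSequence μ)
    (i : Fin n) : FockSpace n →L[ℂ] FockSpace n :=
  LinearMap.mkContinuousOfExistsBound
    { toFun := fun f => ⟨shiftFun μ i f, hμ.memℓp_shiftFun i f⟩
      map_add' := fun f g => by
        ext β
        change shiftFun μ i (f + g : FockSpace n) β = shiftFun μ i f β + shiftFun μ i g β
        by_cases h : ∃ α, FreeMonoid.of i * α = β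
        · obtain ⟨α, rfl⟩ := h
          simp only [shiftFun_of_mul, lp.coeFn_add, Pi.add_apply, mul_add]
        · have h' : ∀ α, FreeMonoid.of i * α ≠ β := fun α hα => h ⟨α, hα⟩
          rw [shiftFun_of_forall_ne μ i _ β h', shiftFun_of_forall_ne μ i _ β h',
            shiftFun_of_forall_ne μ i _ β h', add_zero]
      map_smul' := fun c f => by
        ext β
        change shiftFun μ i (c • f : FockSpace n) β = c * shiftFun μ i f β
        by_cases h : ∃ α, FreeMonoid.of i * α = β
        · obtain ⟨α, rfl⟩ := h
          simp only [shiftFun_of_mul, lp.coeFn_smul, Pi.smul_apply, smul_eq_mul]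
          ring
        · have h' : ∀ α, FreeMonoid.of i * α ≠ β := fun α hα => h ⟨α, hα⟩
          rw [shiftFun_of_forall_ne μ i _ β h', shiftFun_of_forall_ne μ i _ β h', mul_zero] }
    (by
      obtain ⟨C, hC0, hC⟩ := hμ.exists_bound i
      refine ⟨C, fun f => ?_⟩
      refine le_of_sq_le_sq ?_ (by positivity)
      rw [norm_sq_eq_tsum, mul_pow, norm_sq_eq_tsum, ← tsum_mul_left]
      change ∑' β, ‖shiftFun μ i f β‖ ^ 2 ≤ _
      rw [norm_sq_shiftFun, tsum_extend_zero (of_mul_injective i)]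
      exact (hμ.summable_shift i f).tsum_le_tsum (hC f) ((summable_norm_sq f).mul_left _))

/-- The action of the multi-shift on the basis. -/
theorem multiShift_fockBasis {n : ℕ} (μ : FreeMonoid (Fin n) → ℝ) (hμ : IsWeightSequence μ)
    (i : Fin n) (α : FreeMonoid (Fin n)) :
    multiShift μ hμ i (fockBasis α) =
      (μ (FreeMonoid.of i * α) : ℂ) • fockBasis (FreeMonoid.of i * α) := by
  ext β
  change shiftFun μ i (fockBasis α) β = _
  rw [lp.coeFn_smul, Pi.smul_apply, smul_eq_mul]
  unfold fockBasis
  by_cases h : ∃ γ, FreeMonoid.of i * γ = β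
  · obtain ⟨γ, rfl⟩ := h
    rw [shiftFun_of_mul]
    by_cases hγ : γ = α
    · subst hγ
      simp
    · rw [lp.single_apply_ne _ _ _ hγ,
        lp.single_apply_ne _ _ _ fun h => hγ (of_mul_injective i h)]
      simp
  · have h' : ∀ γ, FreeMonoid.of i * γ ≠ β := fun γ hγ => h ⟨γ, hγ⟩
    rw [shiftFun_of_forall_ne μ i _ β h', lp.single_apply_ne _ _ _ (h' α).symm, mul_zero]

/-! ### Bounded point evaluations -/

/-- The set `𝒟(μ)` of all `ζ ∈ ℂⁿ` for which evaluation at `ζ` of polynomials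
`p = ∑ c_α Z_α` in noncommuting indeterminates, `p(ζ) = ∑ c_α ζ_α`, is bounded with respect to the
norm `‖p‖_μ = (∑ μ(α, g_0)² |c_α|²)^{1/2}`. A polynomial is given by its coefficients. -/
def pointEvaluations {n : ℕ} (μ : FreeMonoid (Fin n) → ℝ) : Set (Fin n → ℂ) :=
  {ζ | ∃ C : ℝ, 0 < C ∧ ∀ p : FreeMonoid (Fin n) →₀ ℂ,
    ‖p.sum fun α c => c * FreeMonoid.lift ζ α‖ ≤
      C * √(p.sum fun α c => weightProd μ α ^ 2 * ‖c‖ ^ 2)}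

/-! ### The symmetric weighted Fock space -/

/-- The set `Λ_k` of all words `α` with `ζ_α = ζ^k` for all `ζ ∈ ℂⁿ`. -/
def wordsOfType {n : ℕ} (k : Fin n → ℕ) : Set (FreeMonoid (Fin n)) :=
  {α | ∀ ζ : Fin n → ℂ, FreeMonoid.lift ζ α = ∏ i, ζ i ^ k i}

theorem wordsOfType_finite {n : ℕ} (k : Fin n → ℕ) : (wordsOfType k).Finite := by
  refine (List.finite_length_eq (Fin n) (∑ i, k i)).subset fun (α : FreeMonoid (Fin n)) hα => ?_
  have h := hα fun _ => 2
  rw [FreeMonoid.lift_apply, List.map_const', List.prod_replicate, Finset.prod_pow_eq_pow_sum] at h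
  have h2 : (2 : ℕ) ^ (FreeMonoid.toList α).length = 2 ^ ∑ i, k i := by exact_mod_cast h
  exact Nat.pow_right_injective le_rfl h2

/-- `ω_k = ∑_{α ∈ Λ_k} 1 / μ(α, g_0)²`. -/
noncomputable def symWeight {n : ℕ} (μ : FreeMonoid (Fin n) → ℝ) (k : Fin n → ℕ) : ℝ :=
  ∑ α ∈ (wordsOfType_finite k).toFinset, 1 / weightProd μ α ^ 2

/-- `y^(k) = (1 / ω_k) ∑_{α ∈ Λ_k} (1 / μ(α, g_0)) e_α`. -/
noncomputable def symVector {n : ℕ} (μ : FreeMonoid (Fin n) → ℝ) (k : Fin n → ℕ) : FockSpace n :=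
  ((1 / symWeight μ k : ℝ) : ℂ) •
    ∑ α ∈ (wordsOfType_finite k).toFinset, ((1 / weightProd μ α : ℝ) : ℂ) • fockBasis α

/-- The symmetric weighted Fock space `F_s²(μ)`: the closed span of the vectors `y^(k)`. -/
noncomputable def symFock {n : ℕ} (μ : FreeMonoid (Fin n) → ℝ) : Submodule ℂ (FockSpace n) :=
  (Submodule.span ℂ (Set.range (symVector μ))).topologicalClosure

instance symFock_completeSpace {n : ℕ} (μ : FreeMonoid (Fin n) → ℝ) :
    CompleteSpace (symFock μ) :=
  (Submodule.isClosed_topologicalClosure _).completeSpace_coe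

/-- The compression `B_i = P_{F_s²(μ)} W_i |_{F_s²(μ)}`. -/
noncomputable def symShift {n : ℕ} (μ : FreeMonoid (Fin n) → ℝ) (hμ : IsWeightSequence μ)
    (i : Fin n) : symFock μ →L[ℂ] symFock μ :=
  (symFock μ).orthogonalProjectionOnto ∘L multiShift μ hμ i ∘L (symFock μ).subtypeL

/-! ### The weak-star topology, invariant subspaces and reflexivity -/

/-- The weak-star (that is, `σ`-weak) topology of `B(H)`: the coarsest topology for which all
functionals `T ↦ ∑_j ⟪y_j, T x_j⟫`, with `∑ ‖x_j‖² < ∞` and `∑ ‖y_j‖² < ∞`, are continuous; these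
functionals are exactly the elements of the predual of `B(H)`. -/
noncomputable abbrev weakStarTopology (H : Type*) [NormedAddCommGroup H] [InnerProductSpace ℂ H] :
    TopologicalSpace (H →L[ℂ] H) :=
  ⨅ (x : lp (fun _ : ℕ => H) 2) (y : lp (fun _ : ℕ => H) 2),
    TopologicalSpace.induced (fun T : H →L[ℂ] H => ∑' j, inner ℂ (y j) (T (x j))) inferInstance

/-- The smallest weak-star closed subalgebra of `B(H)` that contains the identity and the set
`S`. -/
noncomputable def weakStarAdjoin {H : Type*} [NormedAddCommGroup H] [InnerProductSpace ℂ H]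
    (S : Set (H →L[ℂ] H)) : Subalgebra ℂ (H →L[ℂ] H) :=
  sInf {𝒜 | S ⊆ 𝒜 ∧ IsClosed[weakStarTopology H] (𝒜 : Set (H →L[ℂ] H))}

/-- `Lat 𝒰`: the closed subspaces that are invariant under every operator in `𝒰`. -/
def invariantSubspaces {H : Type*} [NormedAddCommGroup H] [InnerProductSpace ℂ H]
    (𝒰 : Set (H →L[ℂ] H)) : Set (Submodule ℂ H) :=
  {M | IsClosed (M : Set H) ∧ ∀ A ∈ 𝒰, ∀ x ∈ M, A x ∈ M}

/-- `Alg 𝒮`: the operators that leave every member of `𝒮` invariant. -/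
def operatorsLeaving {H : Type*} [NormedAddCommGroup H] [InnerProductSpace ℂ H]
    (𝒮 : Set (Submodule ℂ H)) : Set (H →L[ℂ] H) :=
  {A | ∀ M ∈ 𝒮, ∀ x ∈ M, A x ∈ M}

/-- An algebra `𝒰` of bounded operators is reflexive if `𝒰 = Alg Lat 𝒰`. -/
def IsReflexive {H : Type*} [NormedAddCommGroup H] [InnerProductSpace ℂ H]
    (𝒰 : Subalgebra ℂ (H →L[ℂ] H)) : Prop :=
  (𝒰 : Set (H →L[ℂ] H)) = operatorsLeaving (invariantSubspaces (𝒰 : Set (H →L[ℂ] H)))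

/-- The Hardy algebra `F_s^∞(μ)`: the weak-star closed algebra generated by `B_1, …, B_n` and the
identity. -/
noncomputable def symHardyAlgebra {n : ℕ} (μ : FreeMonoid (Fin n) → ℝ)
    (hμ : IsWeightSequence μ) : Subalgebra ℂ (symFock μ →L[ℂ] symFock μ) :=
  weakStarAdjoin (Set.range (symShift μ hμ))

end WeightedFock

/-! The vectors `symVector μ k` form an orthogonal total family in `symFock μ`, and the compressions
act on it by `B i (y k) = y (k + e_i)`. So the space behaves like a Hilbert space of power series in
`n` commuting variables, with `B i` multiplication by the `i`-th coordinate. A bounded point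
evaluation at `z` is a vector `κ` with `⟪κ, y k⟫ = z ^ k`, and it is a joint eigenvector of the
adjoints of the `B i`.

The inclusion into Alg Lat is formal. Conversely, let `A` be in Alg Lat. The orthogonal complement
of each `κ` is invariant under the algebra, hence under `A`, so `⟪κ, A f⟫ = ⟪κ, f⟫ * ⟪κ, A (y 0)⟫`.
Since the `κ` for small `z` separate vectors (`eq_zero_of_inner_kernel`), `A` is multiplication by
`φ = A (y 0)` (`apply_monomial_of_mem`). The Fejér means of the power series of `φ` give polynomials
in the `B i` with norm at most `‖A‖` (`opNorm_le_of_fejer`). They converge to `A` entrywise, hence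
weak-star by boundedness (`tendsto_weakStar_of_forall_inner`), so `A` lies in the weak-star closed
algebra. -/

open Filter

namespace WeightedFock

/-! ### Uniqueness of power series coefficients in several variables. -/

section PowerSeries

theorem coeff_eq_zero_of_hasSum_pow {p : ℕ → ℂ}
    (h : ∀ z : ℂ, ‖z‖ < 1 → HasSum (fun d => z ^ d * p d) 0) (d : ℕ) : p d = 0 := by
  have h1 : HasFPowerSeriesAt (0 : ℂ → ℂ) (FormalMultilinearSeries.ofScalars ℂ p) 0 := by
    rw [hasFPowerSeriesAt_iff]
    filter_upwards [Metric.ball_mem_nhds (0 : ℂ) one_pos] with z hz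
    simpa [FormalMultilinearSeries.coeff_ofScalars] using h z (by simpa using hz)
  have h2 := congrArg (fun q => FormalMultilinearSeries.coeff q d) h1.eq_zero
  simp only [FormalMultilinearSeries.coeff_ofScalars] at h2
  exact h2

/-- Along the ray `t * z` the sum, grouped by total degree, is a one-variable power series vanishing
on the unit disc. So every homogeneous component vanishes on the polydisc, and a polynomial
vanishing on a product of infinite sets is zero. -/
theorem coeff_eq_zero_of_hasSum_monomials {n : ℕ} {c : (Fin n → ℕ) → ℂ} {ε : ℝ} (hε : 0 < ε)
    (h : ∀ z : Fin n → ℂ, (∀ i, ‖z i‖ < ε) → HasSum (fun k => c k * ∏ i, z i ^ k i) 0)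
    (k : Fin n → ℕ) : c k = 0 := by
  have hom : ∀ z : Fin n → ℂ, (∀ i, ‖z i‖ < ε) → ∀ d,
      ∑ k ∈ Finset.piAntidiag Finset.univ d, c k * ∏ i, z i ^ k i = 0 := by
    intro z hz
    refine coeff_eq_zero_of_hasSum_pow fun t ht => ?_
    have h1 := h (fun i => t * z i) fun i => by
      rw [norm_mul]
      nlinarith [hz i, norm_nonneg (z i), norm_nonneg t]
    have h2 := h1.tsum_fiberwise fun k => ∑ i, k i
    suffices hfib : ∀ d, t ^ d * ∑ k ∈ Finset.piAntidiag Finset.univ d, c k * ∏ i, z i ^ k i =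
        ∑' b : (fun k : Fin n → ℕ => ∑ i, k i) ⁻¹' {d}, c b * ∏ i, (t * z i) ^ (b : Fin n → ℕ) i by
      rw [funext hfib]
      exact h2
    intro d
    have hset : (fun k : Fin n → ℕ => ∑ i, k i) ⁻¹' {d} =
        (Finset.piAntidiag Finset.univ d : Finset (Fin n → ℕ)) := by
      ext k; simp
    rw [hset, Finset.tsum_subtype' (Finset.piAntidiag Finset.univ d)
      (fun k : Fin n → ℕ => c k * ∏ i, (t * z i) ^ k i), Finset.mul_sum]
    refine Finset.sum_congr rfl fun k hk => ?_
    have hk' : ∑ i, k i = d := (Finset.mem_piAntidiag.1 hk).1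
    simp only [mul_pow, Finset.prod_mul_distrib, Finset.prod_pow_eq_pow_sum, hk']
    ring
  have key : (∑ l ∈ Finset.piAntidiag Finset.univ (∑ i, k i),
      MvPolynomial.monomial (Finsupp.equivFunOnFinite.symm l) (c l)) =
        (0 : MvPolynomial (Fin n) ℂ) := by
    refine MvPolynomial.funext_set (fun _ => Metric.ball 0 ε) (fun _ => ?_) fun z hz => ?_
    · exact infinite_of_mem_nhds 0 (Metric.ball_mem_nhds 0 hε)
    · rw [map_sum, map_zero, ← hom z (fun i => by simpa using hz i trivial) (∑ i, k i)]
      refine Finset.sum_congr rfl fun l _ => ?_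
      rw [MvPolynomial.eval_monomial, Finsupp.prod_fintype _ _ (by simp)]
      rfl
  have := congrArg (MvPolynomial.coeff (Finsupp.equivFunOnFinite.symm k)) key
  simpa [MvPolynomial.coeff_sum, MvPolynomial.coeff_monomial] using this

end PowerSeries

/-! ### Hilbert space tools: bounded convergence, weak-star limits, Fejér multipliers. -/

section Hilbert

variable {H : Type*} [NormedAddCommGroup H] [InnerProductSpace ℂ H]

theorem tendsto_of_mem_closure_span {E : Type*} [NormedAddCommGroup E] [NormedSpace ℂ E]
    {f : ℕ → E →L[ℂ] ℂ} {g : E →L[ℂ] ℂ} {C : ℝ} (hf : ∀ N, ‖f N‖ ≤ C) {s : Set E}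
    (hs : Dense (Submodule.span ℂ s : Set E))
    (h : ∀ x ∈ s, Tendsto (fun N => f N x) atTop (𝓝 (g x))) (x : E) :
    Tendsto (fun N => f N x) atTop (𝓝 (g x)) := by
  have hspan : ∀ x ∈ Submodule.span ℂ s, Tendsto (fun N => f N x) atTop (𝓝 (g x)) := by
    intro x hx
    induction hx using Submodule.span_induction with
    | mem x hx => exact h x hx
    | zero => simp
    | add x y _ _ hx hy => simpa using hx.add hy
    | smul a x _ hx => simpa using hx.const_mul a
  have hC : 0 ≤ C := (norm_nonneg _).trans (hf 0)
  rw [Metric.tendsto_atTop]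
  intro ε hε
  -- `C + ‖g‖` bounds the error of replacing `x` by `x'` in both functionals; the extra `1` makes
  -- `K` positive.
  set K := C + ‖g‖ + 1 with hK
  have hKpos : 0 < K := by positivity
  obtain ⟨x', hx', hd⟩ := Metric.mem_closure_iff.1 (hs x) (ε / (2 * K)) (by positivity)
  obtain ⟨N, hN⟩ := Metric.tendsto_atTop.1 (hspan x' hx') (ε / 2) (by positivity)
  refine ⟨N, fun m hm => ?_⟩
  have h1 := hN m hm
  rw [dist_eq_norm] at h1 hd ⊢
  have h2 : f m x - g x = f m (x - x') - g (x - x') + (f m x' - g x') := by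
    simp only [map_sub]; ring
  have h3 : ‖f m (x - x')‖ ≤ C * ‖x - x'‖ := (f m).le_of_opNorm_le (hf m) _
  have h4 : ‖g (x - x')‖ ≤ ‖g‖ * ‖x - x'‖ := g.le_opNorm _
  have h5 : K * ‖x - x'‖ < ε / 2 := by
    calc K * ‖x - x'‖ < K * (ε / (2 * K)) := by gcongr
      _ = ε / 2 := by field_simp
  rw [h2]
  have h6 := norm_add_le (f m (x - x') - g (x - x')) (f m x' - g x')
  have h7 := norm_sub_le (f m (x - x')) (g (x - x'))
  nlinarith [norm_nonneg (x - x')]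

/-! ### The weak-star topology -/

/-- The uniform bound provides a summable majorant, so dominated convergence passes to the limit
inside each functional defining the topology. -/
theorem tendsto_weakStar_of_forall_inner {T : ℕ → H →L[ℂ] H} {A : H →L[ℂ] H} {C : ℝ}
    (hT : ∀ N, ‖T N‖ ≤ C)
    (h : ∀ x y : H, Tendsto (fun N => inner ℂ y (T N x)) atTop (𝓝 (inner ℂ y (A x)))) :
    Tendsto T atTop (@nhds _ (weakStarTopology H) A) := by
  simp only [nhds_iInf, nhds_induced, tendsto_iInf, tendsto_comap_iff]
  intro x y
  have hsq : ∀ z : lp (fun _ : ℕ => H) 2, Summable fun j => ‖z j‖ ^ 2 := fun z => by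
    simpa using (lp.hasSum_norm (p := 2) (by norm_num) z).summable
  refine tendsto_tsum_of_dominated_convergence
    (bound := fun j => C * (‖y j‖ ^ 2 + ‖x j‖ ^ 2)) (((hsq y).add (hsq x)).mul_left C)
    (fun j => h (x j) (y j)) (Eventually.of_forall fun N j => ?_)
  have hC : 0 ≤ C := (norm_nonneg _).trans (hT 0)
  calc ‖inner ℂ (y j) (T N (x j))‖ ≤ ‖y j‖ * ‖T N (x j)‖ := norm_inner_le_norm _ _
    _ ≤ ‖y j‖ * (C * ‖x j‖) := by gcongr; exact (T N).le_of_opNorm_le (hT N) _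
    _ = C * (‖y j‖ * ‖x j‖) := by ring
    _ ≤ C * (‖y j‖ ^ 2 + ‖x j‖ ^ 2) := by
      gcongr
      nlinarith [sq_nonneg (‖y j‖ - ‖x j‖), sq_nonneg (‖y j‖ + ‖x j‖)]

/-- This is one of the defining functionals, for sequences supported at index `0`. -/
theorem continuous_weakStar_inner (x y : H) :
    Continuous[weakStarTopology H, inferInstance] fun T : H →L[ℂ] H => inner ℂ y (T x) := by
  have h : (fun T : H →L[ℂ] H => inner ℂ y (T x)) = fun T : H →L[ℂ] H =>
      ∑' j, inner ℂ ((lp.single 2 0 y : lp (fun _ : ℕ => H) 2) j)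
        (T ((lp.single 2 0 x : lp (fun _ : ℕ => H) 2) j)) := by
    funext T
    rw [tsum_eq_single 0 fun j hj => by rw [lp.single_apply_ne _ _ _ hj]; simp]
    simp
  rw [h]
  exact continuous_iff_le_induced.2 ((iInf_le _ _).trans (iInf_le _ _))

/-- The operators leaving the orthogonal complement of `κ` invariant. -/
def leavingOrthogonal (κ : H) : Subalgebra ℂ (H →L[ℂ] H) where
  carrier := {T | ∀ x, inner ℂ κ x = 0 → inner ℂ κ (T x) = 0}
  mul_mem' {S T} hS hT x hx := hS _ (hT x hx)
  add_mem' {S T} hS hT x hx := by simp [hS x hx, hT x hx]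
  algebraMap_mem' c x hx := by simp [Algebra.algebraMap_eq_smul_one, hx]

theorem isClosed_leavingOrthogonal (κ : H) :
    IsClosed[weakStarTopology H] (leavingOrthogonal κ : Set (H →L[ℂ] H)) := by
  let _ := weakStarTopology H
  have h : (leavingOrthogonal κ : Set (H →L[ℂ] H)) =
      ⋂ (x : H) (_ : inner ℂ κ x = 0), {T : H →L[ℂ] H | inner ℂ κ (T x) = 0} := by
    ext T
    simp only [Set.mem_iInter]
    rfl
  rw [h]
  exact isClosed_iInter fun x => isClosed_iInter fun _ =>
    isClosed_singleton.preimage (continuous_weakStar_inner x κ)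

/-- If `κ` is a joint eigenvector of the adjoints of the operators in `S`, then every operator in
`Alg Lat` of the weak-star closed algebra generated by `S` has `κ` as an eigenvector of its
adjoint. -/
theorem inner_apply_eq_of_mem_operatorsLeaving {S : Set (H →L[ℂ] H)} {κ y₀ : H}
    (hS : ∀ T ∈ S, ∀ x, inner ℂ κ x = 0 → inner ℂ κ (T x) = 0) (h₀ : inner ℂ κ y₀ = 1)
    {A : H →L[ℂ] H} (hA : A ∈ operatorsLeaving (invariantSubspaces (weakStarAdjoin S : Set _)))
    (f : H) : inner ℂ κ (A f) = inner ℂ κ f * inner ℂ κ (A y₀) := by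
  let M : Submodule ℂ H := (innerSL ℂ κ).ker
  have hM : M ∈ invariantSubspaces (weakStarAdjoin S : Set (H →L[ℂ] H)) := by
    refine ⟨(innerSL ℂ κ).isClosed_ker, fun T hT x hx => ?_⟩
    -- `leavingOrthogonal κ` is itself a weak-star closed subalgebra containing `S`, hence contains
    -- the algebra generated.
    have hT' : T ∈ leavingOrthogonal κ :=
      Algebra.mem_sInf.1 hT (leavingOrthogonal κ) ⟨hS, isClosed_leavingOrthogonal κ⟩
    exact hT' x hx
  have h1 : f - (inner ℂ κ f : ℂ) • y₀ ∈ M := by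
    change inner ℂ κ (f - (inner ℂ κ f : ℂ) • y₀) = 0
    rw [inner_sub_right, inner_smul_right, h₀, mul_one, sub_self]
  have h2 : inner ℂ κ (A (f - (inner ℂ κ f : ℂ) • y₀)) = 0 := hA M hM _ h1
  rw [map_sub, map_smul, inner_sub_right, inner_smul_right] at h2
  exact sub_eq_zero.1 h2

/-! ### Fejér means of operators -/

/-- The number of windows `m ∈ (d, d + N]` common to `d = a` and `d = b`. -/
theorem card_windows (N M a b : ℕ) (hM : a + N < M) (hab : a ≤ b) :
    ((Finset.range M).filter fun m => m ∈ Finset.Ioc a (a + N) ∧ m ∈ Finset.Ioc b (b + N)).card =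
      N - (b - a) := by
  have : ((Finset.range M).filter fun m => m ∈ Finset.Ioc a (a + N) ∧ m ∈ Finset.Ioc b (b + N)) =
      Finset.Ioc b (a + N) := by
    ext m
    simp only [Finset.mem_filter, Finset.mem_range, Finset.mem_Ioc]
    omega
  rw [this, Nat.card_Ioc]
  omega

/-- Schur multiplication of a lower triangular matrix by the Fejér kernel is contractive. -/
theorem opNorm_le_of_fejer {ι : Type*} {e : ι → H} (he : Orthonormal ℂ e)
    (hd : Dense (Submodule.span ℂ (Set.range e) : Set H)) (δ : ι → ℕ) (A S : H →L[ℂ] H) {N : ℕ}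
    (hN : 0 < N) (hA : ∀ k l, ¬ δ k ≤ δ l → inner ℂ (e l) (A (e k)) = 0)
    (hS : ∀ k l, inner ℂ (e l) (S (e k)) =
      ((N - (δ l - δ k) : ℕ) / N : ℂ) * inner ℂ (e l) (A (e k))) : ‖S‖ ≤ ‖A‖ := by
  classical
  have hN' : (0 : ℝ) < N := by exact_mod_cast hN
  have fin : ∀ (s : Finset ι) (a b : ι → ℂ),
      ‖inner ℂ (∑ l ∈ s, b l • e l) (S (∑ k ∈ s, a k • e k))‖ ≤
        ‖A‖ * ‖∑ l ∈ s, b l • e l‖ * ‖∑ k ∈ s, a k • e k‖ := by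
    intro s a b
    -- Large enough for `range M` to contain every window `(δ k, δ k + N]` with `k ∈ s`.
    let M : ℕ := s.sup δ + N + 1
    have hM : ∀ k ∈ s, δ k + N < M := fun k hk => by
      have : δ k ≤ s.sup δ := Finset.le_sup hk
      omega
    -- `P a m` keeps the components of `∑ a k • e k` whose window contains `m`. Indices `k`, `l`
    -- with `δ k ≤ δ l` share `N - (δ l - δ k)` windows, so the form of `S` is `1 / N` times the sum
    -- over `m` of the form of `A` at `P b m`, `P a m`. Each index lies in exactly `N` windows, so
    -- Cauchy–Schwarz in `m` gives the bound `‖A‖`.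
    let w : (ι → ℂ) → ℕ → ι → ℂ := fun a m k => if m ∈ Finset.Ioc (δ k) (δ k + N) then a k else 0
    let P : (ι → ℂ) → ℕ → H := fun a m => ∑ k ∈ s, w a m k • e k
    have hsq : ∀ c : ι → ℂ, ‖∑ k ∈ s, c k • e k‖ ^ 2 = ∑ k ∈ s, ‖c k‖ ^ 2 := fun c => by
      have h1 := he.inner_sum c c s
      rw [inner_self_eq_norm_sq_to_K] at h1
      have h2 : ((‖∑ k ∈ s, c k • e k‖ ^ 2 : ℝ) : ℂ) = ((∑ k ∈ s, ‖c k‖ ^ 2 : ℝ) : ℂ) := by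
        push_cast
        refine Eq.trans (by simp) (h1.trans (Finset.sum_congr rfl fun k _ => ?_))
        exact Complex.conj_mul' _
      exact_mod_cast h2
    have hP : ∀ c : ι → ℂ, ∑ m ∈ Finset.range M, ‖P c m‖ ^ 2 = N * ‖∑ k ∈ s, c k • e k‖ ^ 2 := by
      intro c
      simp only [P, hsq]
      rw [Finset.sum_comm, Finset.mul_sum]
      refine Finset.sum_congr rfl fun k hk => ?_
      have h1 : ∀ m, ‖w c m k‖ ^ 2 = if m ∈ Finset.Ioc (δ k) (δ k + N) ∧
          m ∈ Finset.Ioc (δ k) (δ k + N) then ‖c k‖ ^ 2 else 0 := fun m => by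
        simp only [w, and_self]; split_ifs <;> simp
      simp only [h1]
      rw [← Finset.sum_filter, Finset.sum_const, card_windows N M _ _ (hM k hk) le_rfl]
      simp
    have hform : inner ℂ (∑ l ∈ s, b l • e l) (S (∑ k ∈ s, a k • e k)) =
        (1 / N : ℂ) * ∑ m ∈ Finset.range M, inner ℂ (P b m) (A (P a m)) := by
      have hexp : ∀ (T : H →L[ℂ] H) (b a : ι → ℂ),
          inner ℂ (∑ l ∈ s, b l • e l) (T (∑ k ∈ s, a k • e k)) =
            ∑ l ∈ s, ∑ k ∈ s, starRingEnd ℂ (b l) * (a k * inner ℂ (e l) (T (e k))) := by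
        intro T b a
        simp only [map_sum, map_smul, sum_inner, inner_sum, inner_smul_left, inner_smul_right,
          Finset.mul_sum]
        rw [Finset.sum_comm]
        exact Finset.sum_congr rfl fun l _ => Finset.sum_congr rfl fun k _ => by ring
      simp only [P, hexp]
      conv_rhs => rw [Finset.sum_comm, Finset.mul_sum]
      refine Finset.sum_congr rfl fun l hl => ?_
      rw [Finset.sum_comm, Finset.mul_sum]
      refine Finset.sum_congr rfl fun k hk => ?_
      by_cases hkl : δ k ≤ δ l
      · have h1 : ∀ m, starRingEnd ℂ (w b m l) * (w a m k * inner ℂ (e l) (A (e k))) =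
            if m ∈ Finset.Ioc (δ k) (δ k + N) ∧ m ∈ Finset.Ioc (δ l) (δ l + N) then
              starRingEnd ℂ (b l) * (a k * inner ℂ (e l) (A (e k))) else 0 := fun m => by
          by_cases h1 : m ∈ Finset.Ioc (δ k) (δ k + N) <;>
            by_cases h2 : m ∈ Finset.Ioc (δ l) (δ l + N) <;> simp [w, h1, h2, -Finset.mem_Ioc]
        simp only [h1]
        rw [← Finset.sum_filter, Finset.sum_const, card_windows N M _ _ (hM k hk) hkl, hS]
        simp only [nsmul_eq_mul]
        ring
      -- Above the diagonal truncated subtraction makes the multiplier `1`, not the window count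
      -- over `N`; this is harmless because the entry of `A` is zero.
      · simp [hS, hA k l hkl]
    rw [hform, norm_mul]
    have h1 : ‖∑ m ∈ Finset.range M, inner ℂ (P b m) (A (P a m))‖ ≤
        ‖A‖ * ∑ m ∈ Finset.range M, ‖P b m‖ * ‖P a m‖ := by
      rw [Finset.mul_sum]
      refine (norm_sum_le _ _).trans (Finset.sum_le_sum fun m _ => ?_)
      calc _ ≤ ‖P b m‖ * ‖A (P a m)‖ := norm_inner_le_norm _ _
        _ ≤ ‖P b m‖ * (‖A‖ * ‖P a m‖) := by gcongr; exact A.le_opNorm _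
        _ = _ := by ring
    have h2 : ∑ m ∈ Finset.range M, ‖P b m‖ * ‖P a m‖ ≤
        N * (‖∑ l ∈ s, b l • e l‖ * ‖∑ k ∈ s, a k • e k‖) := by
      refine abs_le_of_sq_le_sq' ?_ (by positivity) |>.2
      refine (Finset.sum_mul_sq_le_sq_mul_sq _ _ _).trans (le_of_eq ?_)
      rw [hP, hP]
      ring
    have h3 : ‖(1 / N : ℂ)‖ = 1 / N := by simp
    rw [h3]
    calc _ ≤ 1 / N * (‖A‖ * (N * (‖∑ l ∈ s, b l • e l‖ * ‖∑ k ∈ s, a k • e k‖))) := by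
          gcongr
          exact h1.trans (by gcongr)
      _ = _ := by field_simp
  have hspan : ∀ x ∈ Submodule.span ℂ (Set.range e), ∀ y ∈ Submodule.span ℂ (Set.range e),
      ‖inner ℂ y (S x)‖ ≤ ‖A‖ * ‖y‖ * ‖x‖ := by
    intro x hx y hy
    obtain ⟨a, rfl⟩ := (Finsupp.mem_span_range_iff_exists_finsupp).1 hx
    obtain ⟨b, rfl⟩ := (Finsupp.mem_span_range_iff_exists_finsupp).1 hy
    rw [Finsupp.sum_of_support_subset a (Finset.subset_union_left (s₂ := b.support)) _ (by simp),
      Finsupp.sum_of_support_subset b (Finset.subset_union_right (s₁ := a.support)) _ (by simp)]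
    exact fin _ _ _
  have hall : ∀ p : H × H, ‖inner ℂ p.2 (S p.1)‖ ≤ ‖A‖ * ‖p.2‖ * ‖p.1‖ := by
    refine fun p => (hd.prod hd).induction
      (P := fun p : H × H => ‖inner ℂ p.2 (S p.1)‖ ≤ ‖A‖ * ‖p.2‖ * ‖p.1‖) ?_ ?_ p
    · rintro ⟨x, y⟩ ⟨hx, hy⟩
      exact hspan x hx y hy
    · exact isClosed_le (by fun_prop) (by fun_prop)
  refine ContinuousLinearMap.opNorm_le_of_re_inner_le (norm_nonneg _) fun x y hx hy => ?_
  rw [inner_re_symm]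
  have := (RCLike.re_le_norm _).trans (hall (x, y))
  simpa [hx, hy] using this

end Hilbert
end WeightedFock


namespace WeightedFock

/-! ### Reflexivity for abstract monomial shifts. -/

section WeightedShift

variable {n : ℕ} {H : Type*} [NormedAddCommGroup H] [InnerProductSpace ℂ H]

/-- A commuting weighted multi-shift: the operators `B i` act on the total orthogonal system
`y k`, `k ∈ ℕ₀ⁿ`, as multiplication by the coordinate functions acts on monomials. -/
structure IsMonomialShift (y : (Fin n → ℕ) → H) (B : Fin n → H →L[ℂ] H) : Prop where
  inner_eq_zero : ∀ k l, k ≠ l → inner ℂ (y k) (y l) = 0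
  ne_zero : ∀ k, y k ≠ 0
  total : ∀ g, (∀ k, inner ℂ (y k) g = 0) → g = 0
  shift : ∀ i k, B i (y k) = y (k + Pi.single i 1)

namespace IsMonomialShift

variable {y : (Fin n → ℕ) → H} {B : Fin n → H →L[ℂ] H}

theorem orthogonal_span (h : IsMonomialShift y B) : (Submodule.span ℂ (Set.range y))ᗮ = ⊥ := by
  refine (Submodule.eq_bot_iff _).2 fun g hg => h.total g fun k => ?_
  exact hg _ (Submodule.subset_span ⟨k, rfl⟩)

theorem dense_span [CompleteSpace H] (h : IsMonomialShift y B) :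
    Dense (Submodule.span ℂ (Set.range y) : Set H) :=
  Submodule.dense_iff_topologicalClosure_eq_top.2
    (Submodule.topologicalClosure_eq_top_iff.2 h.orthogonal_span)

theorem orthonormal (h : IsMonomialShift y B) :
    Orthonormal ℂ fun k => ((‖y k‖⁻¹ : ℝ) : ℂ) • y k := by
  refine ⟨fun k => ?_, fun k l hkl => ?_⟩
  · have := norm_ne_zero_iff.2 (h.ne_zero k)
    rw [norm_smul]
    simp [this]
  · simp [inner_smul_left, inner_smul_right, h.inner_eq_zero k l hkl]

theorem span_normalized (h : IsMonomialShift y B) :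
    Submodule.span ℂ (Set.range fun k => ((‖y k‖⁻¹ : ℝ) : ℂ) • y k) =
      Submodule.span ℂ (Set.range y) := by
  refine le_antisymm (Submodule.span_le.2 ?_) (Submodule.span_le.2 ?_)
  · rintro _ ⟨k, rfl⟩
    exact Submodule.smul_mem _ _ (Submodule.subset_span ⟨k, rfl⟩)
  · rintro _ ⟨k, rfl⟩
    have hk := norm_ne_zero_iff.2 (h.ne_zero k)
    have : y k = (‖y k‖ : ℂ) • ((‖y k‖⁻¹ : ℝ) : ℂ) • y k := by
      rw [smul_smul, Complex.ofReal_inv, mul_inv_cancel₀ (by exact_mod_cast hk), one_smul]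
    rw [this]
    exact Submodule.smul_mem _ _ (Submodule.subset_span ⟨k, rfl⟩)

/-- Parseval writes `⟪κ, g⟫` as a power series in `z` with coefficients `⟪y k, g⟫ / ‖y k‖ ^ 2`; if
it vanishes near the origin, all coefficients vanish. -/
theorem eq_zero_of_inner_kernel [CompleteSpace H] (h : IsMonomialShift y B) {ε : ℝ} (hε : 0 < ε)
    {g : H} (hg : ∀ z : Fin n → ℂ, (∀ i, ‖z i‖ < ε) →
      ∃ κ : H, (∀ k, inner ℂ κ (y k) = ∏ i, z i ^ k i) ∧ inner ℂ κ g = 0) : g = 0 := by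
  let b := HilbertBasis.mkOfOrthogonalEqBot h.orthonormal
    (by rw [h.span_normalized]; exact h.orthogonal_span)
  have hb : ∀ k, b k = ((‖y k‖⁻¹ : ℝ) : ℂ) • y k := fun k => by simp [b]
  refine h.total g fun k => ?_
  have hk : ((‖y k‖⁻¹ : ℝ) : ℂ) ≠ 0 := by
    exact_mod_cast inv_ne_zero (norm_ne_zero_iff.2 (h.ne_zero k))
  have hc := coeff_eq_zero_of_hasSum_monomials
    (c := fun k => ((‖y k‖⁻¹ : ℝ) : ℂ) * (((‖y k‖⁻¹ : ℝ) : ℂ) * inner ℂ (y k) g)) hε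
    (fun z hz => by
      obtain ⟨κ, hκ, hκg⟩ := hg z hz
      have h1 := b.hasSum_inner_mul_inner κ g
      rw [hκg] at h1
      have heq : ∀ k, inner ℂ κ (b k) * inner ℂ (b k) g =
          ((‖y k‖⁻¹ : ℝ) : ℂ) * (((‖y k‖⁻¹ : ℝ) : ℂ) * inner ℂ (y k) g) * ∏ i, z i ^ k i := by
        intro k
        rw [hb, inner_smul_right, inner_smul_left, hκ, Complex.conj_ofReal]
        ring
      simpa only [heq] using h1) k
  have h2 := (mul_eq_zero.1 hc).resolve_left hk
  exact (mul_eq_zero.1 h2).resolve_left hk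

/-- Multiplication by the monomial `z ^ k` belongs to the algebra generated by the `B i`. -/
theorem exists_monomial (h : IsMonomialShift y B) (k : Fin n → ℕ) :
    ∃ T ∈ Algebra.adjoin ℂ (Set.range B), ∀ l, T (y l) = y (l + k) := by
  -- The exponents realized by elements of the algebra form a submonoid, and the unit vectors
  -- generate `ℕ₀ⁿ`.
  let S : AddSubmonoid (Fin n → ℕ) :=
    { carrier := {k | ∃ T ∈ Algebra.adjoin ℂ (Set.range B), ∀ l, T (y l) = y (l + k)}
      zero_mem' := ⟨1, one_mem _, fun l => by simp⟩
      add_mem' := by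
        rintro k k' ⟨T, hT, hk⟩ ⟨T', hT', hk'⟩
        refine ⟨T' * T, mul_mem hT' hT, fun l => ?_⟩
        rw [mul_apply_eq_comp, hk, hk', add_assoc] }
  change k ∈ S
  have hk : k = ∑ i, k i • (Pi.single i 1 : Fin n → ℕ) := by
    ext j
    simp [Finset.sum_apply, Pi.single_apply]
  rw [hk]
  exact sum_mem fun i _ => nsmul_mem
    (show Pi.single i 1 ∈ S from ⟨B i, Algebra.subset_adjoin ⟨i, rfl⟩, h.shift i⟩) _

/-- Two continuous functionals agree if they agree on the monomials. -/
theorem functional_ext [CompleteSpace H] (h : IsMonomialShift y B) {f g : H →L[ℂ] ℂ}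
    (hfg : ∀ k, f (y k) = g (y k)) (x : H) : f x = g x := by
  have : f = g := ContinuousLinearMap.ext_on h.dense_span (by rintro _ ⟨k, rfl⟩; exact hfg k)
  rw [this]

theorem inner_kernel_monomial [CompleteSpace H] (h : IsMonomialShift y B) {κ : H} {z : Fin n → ℂ}
    (hκ : ∀ k, inner ℂ κ (y k) = ∏ i, z i ^ k i) {T : H →L[ℂ] H} {k : Fin n → ℕ}
    (hT : ∀ l, T (y l) = y (l + k)) (x : H) :
    inner ℂ κ (T x) = (∏ i, z i ^ k i) * inner ℂ κ x := by
  refine h.functional_ext (f := innerSL ℂ κ ∘L T) (g := (∏ i, z i ^ k i) • innerSL ℂ κ)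
    (fun l => ?_) x
  simp [hT, hκ, pow_add, Finset.prod_mul_distrib, mul_comm]

/-- An operator in `Alg Lat` of the algebra generated by the `B i` is multiplication by the image
of the constant function `1`. -/
theorem apply_monomial_of_mem [CompleteSpace H] (h : IsMonomialShift y B) {ε : ℝ} (hε : 0 < ε)
    (hker : ∀ z : Fin n → ℂ, (∀ i, ‖z i‖ < ε) →
      ∃ κ : H, ∀ k, inner ℂ κ (y k) = ∏ i, z i ^ k i)
    {A : H →L[ℂ] H}
    (hA : A ∈ operatorsLeaving (invariantSubspaces (weakStarAdjoin (Set.range B) : Set _)))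
    {T : H →L[ℂ] H} {k : Fin n → ℕ} (hT : ∀ l, T (y l) = y (l + k)) :
    A (y k) = T (A (y 0)) := by
  -- Against the kernel at `z`, both vectors have inner product `z ^ k * ⟪κ, A (y 0)⟫`.
  refine sub_eq_zero.1 (h.eq_zero_of_inner_kernel hε fun z hz => ?_)
  obtain ⟨κ, hκ⟩ := hker z hz
  refine ⟨κ, hκ, ?_⟩
  have hB : ∀ S ∈ Set.range B, ∀ x, inner ℂ κ x = 0 → inner ℂ κ (S x) = 0 := by
    rintro _ ⟨i, rfl⟩ x hx
    rw [h.inner_kernel_monomial hκ (h.shift i), hx, mul_zero]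
  rw [inner_sub_right, h.inner_kernel_monomial hκ hT,
    inner_apply_eq_of_mem_operatorsLeaving (y₀ := y 0) hB (by simp [hκ]) hA, hκ, sub_self]

theorem inner_monomial_of_not_le [CompleteSpace H] (h : IsMonomialShift y B) {T : H →L[ℂ] H}
    {k m : Fin n → ℕ} (hT : ∀ l, T (y l) = y (l + k)) (hkm : ¬ k ≤ m) (x : H) :
    inner ℂ (y m) (T x) = 0 := by
  refine h.functional_ext (f := innerSL ℂ (y m) ∘L T) (g := 0) (fun l => ?_) x
  have : m ≠ l + k := by rintro rfl; exact hkm le_add_self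
  simp [hT, h.inner_eq_zero _ _ this]

/-- The coefficient of `z ^ (m + k)` in `z ^ k * x` is the coefficient of `z ^ m` in `x`; the self
inner products convert between coefficients and inner products. -/
theorem inner_monomial_add [CompleteSpace H] (h : IsMonomialShift y B) {T : H →L[ℂ] H}
    {k : Fin n → ℕ} (hT : ∀ l, T (y l) = y (l + k)) (m : Fin n → ℕ) (x : H) :
    inner ℂ (y (m + k)) (T x) =
      inner ℂ (y m) x / inner ℂ (y m) (y m) * inner ℂ (y (m + k)) (y (m + k)) := by
  have hm : inner ℂ (y m) (y m) ≠ 0 := inner_self_ne_zero.2 (h.ne_zero m)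
  have := h.functional_ext (f := innerSL ℂ (y (m + k)) ∘L T)
    (g := (inner ℂ (y (m + k)) (y (m + k)) / inner ℂ (y m) (y m)) • innerSL ℂ (y m))
    (fun l => by
      by_cases hl : m = l
      · subst hl
        simp only [ContinuousLinearMap.comp_apply, hT, innerSL_apply_apply,
          smul_apply, smul_eq_mul]
        field_simp
      · have hl' : m + k ≠ l + k := fun h => hl (add_right_cancel h)
        simp [hT, h.inner_eq_zero _ _ hl, h.inner_eq_zero _ _ hl']) x
  simp only [ContinuousLinearMap.comp_apply, innerSL_apply_apply,
    smul_apply, smul_eq_mul] at this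
  rw [this]
  ring

/-- The algebra generated by a monomial shift with bounded point evaluations near the origin is
reflexive. -/
theorem isReflexive [CompleteSpace H] (h : IsMonomialShift y B) {ε : ℝ} (hε : 0 < ε)
    (hker : ∀ z : Fin n → ℂ, (∀ i, ‖z i‖ < ε) →
      ∃ κ : H, ∀ k, inner ℂ κ (y k) = ∏ i, z i ^ k i) :
    IsReflexive (weakStarAdjoin (Set.range B)) := by
  refine Set.Subset.antisymm (fun A hA M hM => hM.2 A hA) fun A hA => ?_
  choose T hTmem hT using h.exists_monomial
  have hAT : ∀ k, A (y k) = T k (A (y 0)) := fun k => h.apply_monomial_of_mem hε hker hA (hT k)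
  let δ : (Fin n → ℕ) → ℕ := fun k => ∑ i, k i
  have hδ : ∀ k l, δ (k + l) = δ k + δ l := fun k l => by simp [δ, Finset.sum_add_distrib]
  -- The power series coefficients of `A (y 0)`; `σ N` is its Fejér mean of order `N + 1`, with each
  -- monomial replaced by the operator `T l`.
  let c : (Fin n → ℕ) → ℂ := fun l => inner ℂ (y l) (A (y 0)) / inner ℂ (y l) (y l)
  let σ : ℕ → H →L[ℂ] H := fun N => ∑ d ∈ Finset.range (N + 1),
    ∑ l ∈ Finset.piAntidiag Finset.univ d, (((N + 1 - d : ℕ) / (N + 1 : ℕ) : ℂ) * c l) • T l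
  have hA0 : ∀ k m, ¬ k ≤ m → inner ℂ (y m) (A (y k)) = 0 := fun k m hkm => by
    rw [hAT, h.inner_monomial_of_not_le (hT k) hkm]
  have hσ : ∀ N k m, inner ℂ (y m) (σ N (y k)) =
      ((N + 1 - (δ m - δ k) : ℕ) / (N + 1 : ℕ) : ℂ) * inner ℂ (y m) (A (y k)) := by
    intro N k m
    have hexp : inner ℂ (y m) (σ N (y k)) = ∑ d ∈ Finset.range (N + 1),
        ∑ l ∈ Finset.piAntidiag Finset.univ d,
          (((N + 1 - d : ℕ) / (N + 1 : ℕ) : ℂ) * c l) * inner ℂ (y m) (y (k + l)) := by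
      simp only [σ, sum_apply, inner_sum, smul_apply, hT,
        inner_smul_right]
    rw [hexp]
    by_cases hkm : k ≤ m
    · obtain ⟨l, rfl⟩ := exists_add_of_le hkm
      have hd : δ (k + l) - δ k = δ l := by rw [hδ]; omega
      have hval : inner ℂ (y (k + l)) (A (y k)) = c l * inner ℂ (y (k + l)) (y (k + l)) := by
        rw [hAT, add_comm k l, h.inner_monomial_add (hT k)]
      have hne : ∀ l', l' ≠ l → inner ℂ (y (k + l)) (y (k + l')) = 0 := fun l' hl' =>
        h.inner_eq_zero _ _ fun h => hl' (add_left_cancel h).symm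
      rw [hd, hval, Finset.sum_eq_single (δ l)]
      · rw [Finset.sum_eq_single l]
        · ring
        · intro l' _ hl'
          rw [hne l' hl', mul_zero]
        · intro hl
          exact absurd (by simp [δ]) hl
      · intro d _ hd
        refine Finset.sum_eq_zero fun l' hl' => ?_
        rw [hne l' (by rintro rfl; exact hd (Finset.mem_piAntidiag.1 hl').1.symm), mul_zero]
      -- For degrees above `N` the truncated numerator is `0`, which agrees with the absence of such
      -- terms in `σ N`.
      · intro hl
        have : N + 1 - δ l = 0 := by
          rw [Finset.mem_range] at hl
          omega
        simp [this]
    · rw [hA0 k m hkm, mul_zero]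
      refine Finset.sum_eq_zero fun d _ => Finset.sum_eq_zero fun l _ => ?_
      rw [h.inner_eq_zero, mul_zero]
      rintro rfl
      exact hkm le_self_add
  have hbound : ∀ N, ‖σ N‖ ≤ ‖A‖ := fun N => by
    refine opNorm_le_of_fejer h.orthonormal (by rw [h.span_normalized]; exact h.dense_span) δ A
      (σ N) N.succ_pos (fun k l hkl => ?_) fun k l => ?_
    · have : ¬ k ≤ l := fun hle => hkl (Finset.sum_le_sum fun i _ => hle i)
      simp [hA0 k l this]
    · simp only [map_smul, inner_smul_left, inner_smul_right, hσ]
      push_cast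
      ring
  have hmono : ∀ k m, Tendsto (fun N => inner ℂ (y m) (σ N (y k))) atTop
      (𝓝 (inner ℂ (y m) (A (y k)))) := by
    intro k m
    simp only [hσ]
    have hlim : Tendsto (fun N : ℕ => ((N + 1 - (δ m - δ k) : ℕ) / (N + 1 : ℕ) : ℂ)) atTop (𝓝 1) := by
      generalize δ m - δ k = D
      have h0 := (tendsto_one_div_add_atTop_nhds_zero_nat (𝕜 := ℂ)).const_mul (D : ℂ)
      have h1 := h0.const_sub 1
      rw [mul_zero, sub_zero] at h1
      refine h1.congr' ?_
      filter_upwards [eventually_ge_atTop D] with N hN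
      have hN0 : (N : ℂ) + 1 ≠ 0 := by exact_mod_cast N.succ_ne_zero
      rw [Nat.cast_sub (by omega)]
      push_cast
      field_simp
    simpa using hlim.mul_const (inner ℂ (y m) (A (y k)))
  -- Density is used once in each argument; conjugation turns the dependence on `x'` into a linear
  -- functional.
  have hwot : ∀ x x' : H, Tendsto (fun N => inner ℂ x' (σ N x)) atTop (𝓝 (inner ℂ x' (A x))) := by
    have h1 : ∀ x m, Tendsto (fun N => inner ℂ (y m) (σ N x)) atTop (𝓝 (inner ℂ (y m) (A x))) := by
      intro x m
      refine tendsto_of_mem_closure_span (f := fun N => innerSL ℂ (y m) ∘L σ N)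
        (g := innerSL ℂ (y m) ∘L A) (C := ‖innerSL ℂ (y m)‖ * ‖A‖) (fun N => ?_) h.dense_span
        (by rintro _ ⟨k, rfl⟩; exact hmono k m) x
      exact (ContinuousLinearMap.opNorm_comp_le _ _).trans (by gcongr; exact hbound N)
    intro x x'
    have h2 := tendsto_of_mem_closure_span (f := fun N => innerSL ℂ (σ N x))
      (g := innerSL ℂ (A x)) (C := ‖A‖ * ‖x‖)
      (fun N => by rw [innerSL_apply_norm]; exact (σ N).le_of_opNorm_le (hbound N) x)
      h.dense_span (by
        rintro _ ⟨m, rfl⟩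
        simpa [Function.comp_def] using (Complex.continuous_conj.tendsto _).comp (h1 x m)) x'
    simpa [Function.comp_def] using (Complex.continuous_conj.tendsto _).comp h2
  refine Algebra.mem_sInf.2 fun 𝒜 h𝒜 => ?_
  let _ := weakStarTopology H
  refine IsClosed.mem_of_tendsto h𝒜.2 (tendsto_weakStar_of_forall_inner hbound hwot)
    (Eventually.of_forall fun N => ?_)
  exact sum_mem fun d _ => sum_mem fun l _ =>
    Subalgebra.smul_mem _ (Algebra.adjoin_le h𝒜.1 (hTmem l)) _

end IsMonomialShift

end WeightedShift
end WeightedFock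


namespace WeightedFock

/-! ### Words and their commutative types. -/

section Words

variable {n : ℕ}

theorem lift_eq_prod_count (z : Fin n → ℂ) (α : FreeMonoid (Fin n)) :
    FreeMonoid.lift z α = ∏ i, z i ^ (FreeMonoid.toList α).count i := by
  rw [FreeMonoid.lift_apply, Finset.prod_list_map_count]
  refine Finset.prod_subset (Finset.subset_univ _) fun i _ hi => ?_
  rw [List.count_eq_zero_of_not_mem (fun h => hi (List.mem_toFinset.2 h)), pow_zero]

theorem mem_wordsOfType_iff {k : Fin n → ℕ} {α : FreeMonoid (Fin n)} :
    α ∈ wordsOfType k ↔ (fun i => (FreeMonoid.toList α).count i) = k := by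
  refine ⟨fun h => funext fun i => ?_, fun h z => by rw [lift_eq_prod_count, ← h]⟩
  -- With `2` in coordinate `i` and `1` elsewhere, only the exponent of the letter `i` is visible.
  have h1 := h (Function.update 1 i 2)
  rw [lift_eq_prod_count, Finset.prod_eq_single i (by simp +contextual) (by simp),
    Finset.prod_eq_single i (by simp +contextual) (by simp)] at h1
  simp only [Function.update_self] at h1
  exact Nat.pow_right_injective le_rfl (by exact_mod_cast h1)

theorem wordsOfType_nonempty (k : Fin n → ℕ) : (wordsOfType k).Nonempty := by
  refine ⟨FreeMonoid.ofList (∑ i, Multiset.replicate (k i) i).toList,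
    mem_wordsOfType_iff.2 (funext fun i => ?_)⟩
  rw [FreeMonoid.toList_ofList, ← Multiset.coe_count, Multiset.coe_toList, Multiset.count_sum']
  simp [Multiset.count_replicate]

theorem of_mul_mem_wordsOfType {k : Fin n → ℕ} {α : FreeMonoid (Fin n)} (hα : α ∈ wordsOfType k)
    (i : Fin n) : FreeMonoid.of i * α ∈ wordsOfType (k + Pi.single i 1) := fun z => by
  have h : ∏ j, z j ^ (Pi.single i 1 : Fin n → ℕ) j = z i := by
    rw [Finset.prod_eq_single i (by simp +contextual) (by simp), Pi.single_eq_same, pow_one]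
  simp only [Pi.add_apply, pow_add, Finset.prod_mul_distrib, h]
  rw [map_mul, FreeMonoid.lift_eval_of, hα z, mul_comm]

theorem eq_of_mem_wordsOfType {k l : Fin n → ℕ} {α : FreeMonoid (Fin n)} (hk : α ∈ wordsOfType k)
    (hl : α ∈ wordsOfType l) : k = l :=
  (mem_wordsOfType_iff.1 hk).symm.trans (mem_wordsOfType_iff.1 hl)

end Words

/-! ### The symmetric Fock space as a monomial shift. -/

section SymmetricFock

variable {n : ℕ} {μ : FreeMonoid (Fin n) → ℝ}

theorem weightProd_of_mul (i : Fin n) (α : FreeMonoid (Fin n)) :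
    weightProd μ (FreeMonoid.of i * α) = μ (FreeMonoid.of i * α) * weightProd μ α := rfl

theorem IsWeightSequence.weightProd_pos (hμ : IsWeightSequence μ) (α : FreeMonoid (Fin n)) :
    0 < weightProd μ α := by
  induction α using FreeMonoid.inductionOn' with
  | one => exact one_pos
  | of_mul i α ih =>
    rw [weightProd_of_mul]
    exact mul_pos (hμ.pos _ fun h => by simpa using congrArg FreeMonoid.length h) ih

theorem IsWeightSequence.symWeight_pos (hμ : IsWeightSequence μ) (k : Fin n → ℕ) :
    0 < symWeight μ k := by
  refine Finset.sum_pos (fun α _ => ?_) ?_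
  · have := hμ.weightProd_pos α
    positivity
  · exact (Set.Finite.toFinset_nonempty _).2 (wordsOfType_nonempty k)

theorem inner_fockBasis (f : FockSpace n) (α : FreeMonoid (Fin n)) :
    inner ℂ f (fockBasis α) = starRingEnd ℂ (f α) := by
  rw [fockBasis, lp.inner_single_right]
  simp

theorem inner_symVector (f : FockSpace n) (k : Fin n → ℕ) :
    inner ℂ f (symVector μ k) = ((1 / symWeight μ k : ℝ) : ℂ) *
      ∑ α ∈ (wordsOfType_finite k).toFinset, ((1 / weightProd μ α : ℝ) : ℂ) *
        starRingEnd ℂ (f α) := by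
  simp only [symVector, inner_smul_right, inner_sum, inner_fockBasis]

open Classical in
theorem symVector_apply (k : Fin n → ℕ) (α : FreeMonoid (Fin n)) :
    symVector μ k α = if α ∈ wordsOfType k then
      ((1 / symWeight μ k : ℝ) : ℂ) * ((1 / weightProd μ α : ℝ) : ℂ) else 0 := by
  have h : starRingEnd ℂ (symVector μ k α) = starRingEnd ℂ (if α ∈ wordsOfType k then
      ((1 / symWeight μ k : ℝ) : ℂ) * ((1 / weightProd μ α : ℝ) : ℂ) else 0) := by
    rw [← inner_fockBasis, symVector, inner_smul_left, sum_inner]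
    simp only [inner_smul_left, inner_fockBasis, Complex.conj_ofReal]
    rw [apply_ite (starRingEnd ℂ), map_mul, Complex.conj_ofReal, Complex.conj_ofReal, map_zero]
    by_cases hα : α ∈ wordsOfType k
    · rw [Finset.sum_eq_single α, if_pos hα]
      · simp [fockBasis]
      · intro β _ hβ
        rw [fockBasis, lp.single_apply_ne _ _ _ hβ.symm]
        simp
      · intro h
        exact absurd ((wordsOfType_finite k).mem_toFinset.2 hα) h
    · rw [if_neg hα, Finset.sum_eq_zero, mul_zero]
      intro β hβ
      have : α ≠ β := by
        rintro rfl
        exact hα ((wordsOfType_finite k).mem_toFinset.1 hβ)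
      rw [fockBasis, lp.single_apply_ne _ _ _ this]
      simp
  exact (starRingEnd ℂ).injective h

theorem inner_symVector_of_ne {k l : Fin n → ℕ} (hkl : k ≠ l) :
    inner ℂ (symVector μ k) (symVector μ l) = 0 := by
  rw [inner_symVector, Finset.sum_eq_zero, mul_zero]
  intro α hα
  have hα' : α ∉ wordsOfType k := fun h =>
    hkl (eq_of_mem_wordsOfType h ((wordsOfType_finite l).mem_toFinset.1 hα))
  rw [symVector_apply, if_neg hα', map_zero, mul_zero]

theorem sum_weightProd_mul_conj_symVector (hμ : IsWeightSequence μ) (k : Fin n → ℕ) :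
    ∑ α ∈ (wordsOfType_finite k).toFinset, ((1 / weightProd μ α : ℝ) : ℂ) *
      starRingEnd ℂ (symVector μ k α) = 1 := by
  have h1 : ∀ α ∈ (wordsOfType_finite k).toFinset, ((1 / weightProd μ α : ℝ) : ℂ) *
      starRingEnd ℂ (symVector μ k α) =
        ((1 / symWeight μ k : ℝ) : ℂ) * ((1 / weightProd μ α ^ 2 : ℝ) : ℂ) := fun α hα => by
    rw [symVector_apply, if_pos ((wordsOfType_finite k).mem_toFinset.1 hα), map_mul,
      Complex.conj_ofReal, Complex.conj_ofReal]
    push_cast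
    ring
  rw [Finset.sum_congr rfl h1, ← Finset.mul_sum, ← Complex.ofReal_sum, ← Complex.ofReal_mul,
    ← symWeight, one_div_mul_cancel (hμ.symWeight_pos k).ne', Complex.ofReal_one]

theorem inner_symVector_self (hμ : IsWeightSequence μ) (k : Fin n → ℕ) :
    inner ℂ (symVector μ k) (symVector μ k) = ((1 / symWeight μ k : ℝ) : ℂ) := by
  rw [inner_symVector, sum_weightProd_mul_conj_symVector hμ, mul_one]

/-- `W_i` sends words of type `k` to words of type `k + e_i`. The factor `μ (g_i α)` cancels against
the one in `weightProd μ (g_i α)`, and the remaining sum of `1 / weightProd μ α ^ 2` is `symWeight μ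
k`, which cancels the normalization. Only inner products are compared: `W_i y^(k)` lives on words
beginning with `g_i`, so it need not equal `y^(k + e_i)` before projection. -/
theorem inner_symVector_multiShift (hμ : IsWeightSequence μ) (i : Fin n) (k l : Fin n → ℕ) :
    inner ℂ (symVector μ l) (multiShift μ hμ i (symVector μ k)) =
      inner ℂ (symVector μ l) (symVector μ (k + Pi.single i 1)) := by
  have hexp : inner ℂ (symVector μ l) (multiShift μ hμ i (symVector μ k)) =
      ((1 / symWeight μ k : ℝ) : ℂ) * ∑ α ∈ (wordsOfType_finite k).toFinset,
        ((1 / weightProd μ α : ℝ) : ℂ) * ((μ (FreeMonoid.of i * α) : ℂ) *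
          starRingEnd ℂ (symVector μ l (FreeMonoid.of i * α))) := by
    rw [symVector.eq_def μ k, map_smul, map_sum, inner_smul_right, inner_sum]
    simp only [map_smul, multiShift_fockBasis, inner_smul_right, inner_fockBasis]
  rw [hexp]
  by_cases hl : l = k + Pi.single i 1
  · subst hl
    rw [inner_symVector_self hμ]
    have h1 : ∀ α ∈ (wordsOfType_finite k).toFinset, ((1 / weightProd μ α : ℝ) : ℂ) *
        ((μ (FreeMonoid.of i * α) : ℂ) *
          starRingEnd ℂ (symVector μ (k + Pi.single i 1) (FreeMonoid.of i * α))) =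
        ((1 / symWeight μ (k + Pi.single i 1) : ℝ) : ℂ) * ((1 / weightProd μ α ^ 2 : ℝ) : ℂ) := by
      intro α hα
      have hμα : μ (FreeMonoid.of i * α) ≠ 0 :=
        (hμ.pos _ fun h => by simpa using congrArg FreeMonoid.length h).ne'
      have hα' := (hμ.weightProd_pos α).ne'
      rw [symVector_apply, if_pos (of_mul_mem_wordsOfType
        ((wordsOfType_finite k).mem_toFinset.1 hα) i), map_mul, Complex.conj_ofReal,
        Complex.conj_ofReal, weightProd_of_mul]
      simp only [← Complex.ofReal_mul]
      congr 1
      field_simp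
    rw [Finset.sum_congr rfl h1, ← Finset.mul_sum, ← Complex.ofReal_sum, ← symWeight,
      ← Complex.ofReal_mul, ← Complex.ofReal_mul]
    have := (hμ.symWeight_pos k).ne'
    congr 1
    field_simp
  · rw [inner_symVector_of_ne hl, Finset.sum_eq_zero, mul_zero]
    intro α hα
    have hα' : FreeMonoid.of i * α ∉ wordsOfType l := fun h => hl (eq_of_mem_wordsOfType h
      (of_mul_mem_wordsOfType ((wordsOfType_finite k).mem_toFinset.1 hα) i))
    rw [symVector_apply, if_neg hα', map_zero, mul_zero, mul_zero]

/-- Bounded point evaluations are given by vectors of the full Fock space. -/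
theorem exists_kernel (hμ : IsWeightSequence μ) {z : Fin n → ℂ} (hz : z ∈ pointEvaluations μ) :
    ∃ κ : FockSpace n, ∀ k, inner ℂ κ (symVector μ k) = ∏ i, z i ^ k i := by
  obtain ⟨C, hC, hb⟩ := hz
  let f : FreeMonoid (Fin n) → ℂ := fun α =>
    starRingEnd ℂ (FreeMonoid.lift z α) / (weightProd μ α : ℂ)
  have hf : Memℓp f 2 := by
    refine memℓp_gen' (C := C ^ 2) fun s => ?_
    have h2 : (2 : ENNReal).toReal = (2 : ℕ) := by norm_num
    simp only [h2, Real.rpow_natCast]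
    set S := ∑ α ∈ s, ‖f α‖ ^ 2 with hS
    have hS0 : 0 ≤ S := Finset.sum_nonneg fun _ _ => by positivity
    have hwpos := hμ.weightProd_pos
    -- For this test polynomial the value at `z` and the squared norm both equal `S`, so `S ≤ C *
    -- √S` and hence `S ≤ C ^ 2`.
    have hb' := hb (Finsupp.onFinset s (fun α => if α ∈ s then
      starRingEnd ℂ (FreeMonoid.lift z α) / (weightProd μ α : ℂ) ^ 2 else 0)
      (fun α h => by by_contra hα; simp [hα] at h))
    rw [Finsupp.onFinset_sum _ (by simp), Finsupp.onFinset_sum _ (by simp)] at hb'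
    have e1 : ∑ α ∈ s, (if α ∈ s then
        starRingEnd ℂ (FreeMonoid.lift z α) / (weightProd μ α : ℂ) ^ 2 else 0) *
          FreeMonoid.lift z α = (S : ℂ) := by
      rw [hS, Complex.ofReal_sum]
      refine Finset.sum_congr rfl fun α hα => ?_
      rw [if_pos hα, div_mul_eq_mul_div, Complex.conj_mul']
      simp only [f, norm_div, RCLike.norm_conj, Complex.norm_real, Real.norm_of_nonneg (hwpos α).le]
      push_cast
      rw [div_pow]
    have e2 : ∑ α ∈ s, weightProd μ α ^ 2 * ‖if α ∈ s then
        starRingEnd ℂ (FreeMonoid.lift z α) / (weightProd μ α : ℂ) ^ 2 else 0‖ ^ 2 = S := by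
      refine Finset.sum_congr rfl fun α hα => ?_
      have := (hwpos α).ne'
      rw [if_pos hα]
      simp only [f, norm_div, RCLike.norm_conj, norm_pow, Complex.norm_real,
        Real.norm_of_nonneg (hwpos α).le]
      field_simp
    rw [e1, e2, Complex.norm_real, Real.norm_of_nonneg hS0] at hb'
    have hsq := Real.sq_sqrt hS0
    have h0 := Real.sqrt_nonneg S
    rcases h0.eq_or_lt with h | h
    · rw [← hsq, ← h, zero_pow two_ne_zero]; positivity
    · have : √S ≤ C := by nlinarith
      rw [← hsq]; gcongr
  refine ⟨⟨f, hf⟩, fun k => ?_⟩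
  rw [inner_symVector]
  have h1 : ∀ α ∈ (wordsOfType_finite k).toFinset, ((1 / weightProd μ α : ℝ) : ℂ) *
      starRingEnd ℂ ((⟨f, hf⟩ : FockSpace n) α) =
        ((1 / weightProd μ α ^ 2 : ℝ) : ℂ) * ∏ i, z i ^ k i := fun α hα => by
    change _ * starRingEnd ℂ (f α) = _
    have hα' := (wordsOfType_finite k).mem_toFinset.1 hα
    rw [map_div₀, Complex.conj_conj, Complex.conj_ofReal, hα' z]
    push_cast
    ring
  rw [Finset.sum_congr rfl h1, ← Finset.sum_mul, ← Complex.ofReal_sum, ← symWeight, ← mul_assoc,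
    ← Complex.ofReal_mul, one_div_mul_cancel (hμ.symWeight_pos k).ne', Complex.ofReal_one, one_mul]

theorem symVector_mem (k : Fin n → ℕ) : symVector μ k ∈ symFock μ :=
  Submodule.le_topologicalClosure _ (Submodule.subset_span ⟨k, rfl⟩)

theorem isMonomialShift_symShift (hμ : IsWeightSequence μ) :
    IsMonomialShift (fun k => (⟨symVector μ k, symVector_mem k⟩ : symFock μ)) (symShift μ hμ) := by
  have total : ∀ g : symFock μ,
      (∀ k, inner ℂ (symVector μ k) (g : FockSpace n) = 0) → g = 0 := by
    intro g hg
    have h1 : symFock μ ≤ (innerSL ℂ (g : FockSpace n)).ker := by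
      refine Submodule.topologicalClosure_minimal _ (Submodule.span_le.2 ?_)
        (innerSL ℂ (g : FockSpace n)).isClosed_ker
      rintro _ ⟨k, rfl⟩
      exact inner_eq_zero_symm.1 (hg k)
    have h2 : inner ℂ (g : FockSpace n) (g : FockSpace n) = 0 := h1 g.2
    exact Subtype.ext (inner_self_eq_zero.1 h2)
  refine ⟨fun k l hkl => inner_symVector_of_ne hkl, fun k hk => ?_, total, fun i k => ?_⟩
  · have h1 := inner_symVector_self hμ k
    rw [show symVector μ k = 0 from congrArg Subtype.val hk, inner_zero_left] at h1
    have := (hμ.symWeight_pos k).ne'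
    exact one_div_ne_zero this (by exact_mod_cast h1.symm)
  -- Tested against `y^(l)`, which lies in the subspace, the projection drops out.
  · refine sub_eq_zero.1 (total _ fun l => ?_)
    rw [Submodule.coe_sub, inner_sub_right, sub_eq_zero]
    refine (Submodule.inner_orthogonalProjectionOnto_eq_of_mem_left (K := symFock μ)
      ⟨symVector μ l, symVector_mem l⟩ (multiShift μ hμ i (symVector μ k))).trans ?_
    exact inner_symVector_multiShift hμ i k l

end SymmetricFock

end WeightedFock

theorem theorem6p4 (n : ℕ) (μ : FreeMonoid (Fin n) → ℝ)
    (hμ : WeightedFock.IsWeightSequence μ)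
    (hD : WeightedFock.pointEvaluations μ ∈ 𝓝 (0 : Fin n → ℂ)) :
    WeightedFock.IsReflexive (WeightedFock.symHardyAlgebra μ hμ) := by
  obtain ⟨ε, hε, hball⟩ := Metric.mem_nhds_iff.1 hD
  refine (WeightedFock.isMonomialShift_symShift hμ).isReflexive hε fun z hz => ?_
  have hz' : z ∈ Metric.ball (0 : Fin n → ℂ) ε := by
    rw [mem_ball_zero_iff]
    exact (pi_norm_lt_iff hε).2 hz
  obtain ⟨κ, hκ⟩ := WeightedFock.exists_kernel hμ (hball hz')
  -- Projecting `κ` does not change its inner products with vectors of the subspace.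
  refine ⟨(WeightedFock.symFock μ).orthogonalProjectionOnto κ, fun k => ?_⟩
  rw [Submodule.inner_orthogonalProjectionOnto_eq_of_mem_right]
  exact hκ k
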